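/- Let $(\Omega,\mathcal F,\mathbb P)$ and $(X,\mathcal A,m)$ be standard Borel probability spaces, let $\sigma:\Omega\to\Omega$ be an invertible (bimeasurable), ergodic, $\mathbb P$-preserving transformation, and let $I$ be a non-empty countable set. Let $T_\omega:X\to X$ ($\omega\in\Omega$) be transformations that are non-singular with respect to $m$ (i.e. $m(A)=0$ implies $m(T_\omega^{-1}A)=0$) and such that $(\omega,x)\mapsto T_\omega x$ is measurable. Write $T^{(n)}_\omega=T_{\sigma^{n-1}\omega}\circ\cdots\circ T_{\sigma\omega}\circ T_\omega$, $T^{(0)}_\omega=\mathrm{id}$. Assume: (1) there is a measurable partition $\{X_i\}_{i\in I}$ of $X$ up to $m$-null sets, independent of $\omega$, such that for $\mathbb P$-a.e. $\omega$ every restriction $T_\omega|_{X_i}:X_i\to T_\omega X_i$, $i\in I$, is invertible. For $n\ge 1$ and $i_1,\dots,i_n\in I$ put $$X^\omega_{i_1\dots i_n}=\bigcap_{k=0}^{n-1}\bigl(T^{(k)}_{\sigma^{-n}\omega}\bigr)^{-1}X_{i_{k+1}},$$ and let $V^\omega_{i_1\dots i_n}:T^{(n)}_{\sigma^{-n}\omega}X^\omega_{i_1\dots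 i_n}\to X^\omega_{i_1\dots i_n}$ be the inverse of $T^{(n)}_{\sigma^{-n}\omega}$ restricted to the cylinder $X^\omega_{i_1\dots i_n}$; (2) for $\mathbb P$-a.e. $\omega$, the $\sigma$-algebra generated by the cylinders $\{X^\omega_{i_1\dots i_n}: n\ge1,\ i_1,\dots,i_n\in I\}$ equals $\mathcal A$ modulo $m$-null sets; (3) there is $C\ge1$ such that for $\mathbb P$-a.e. $\omega$, all $n\ge1$ and every cylinder with $m(X^\omega_{i_1\dots i_n})>0$, $$\operatorname*{ess\,sup}_{T^{(n)}_{\sigma^{-n}\omega}X^\omega_{i_1\dots i_n}}\frac{d(m\circ V^\omega_{i_1\dots i_n})}{dm}\le C\operatorname*{ess\,inf}_{T^{(n)}_{\sigma^{-n}\omega}X^\omega_{i_1\dots i_n}}\frac{d(m\circ V^\omega_{i_1\dots i_n})}{dm};$$ (4) there is $c>0$ such that for $\mathbb P$-a.e. $\omega$, all $n\ge1$ and every cylinder with $m(X^\omega_{i_1\dots i_n})>0$, $m\bigl(T^{(n)}_{\sigma^{-n}\omega}X^\omega_{i_1\dots i_n}\bigr)>c$. Let $P_\omega:L^1(X,m)\to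 L^1(X,m)$ be the Perron--Frobenius operator of $T_\omega$, determined by $\int_X P_\omega f\cdot g\,dm=\int_X f\cdot g\circ T_\omega\,dm$ for $f\in L^1(X,m)$, $g\in L^\infty(X,m)$, and let $P^{(n)}_\omega=P_{\sigma^{n-1}\omega}\circ\cdots\circ P_\omega$, $P^{(0)}_\omega=\mathrm{id}$. Then: (a) for $\mathbb P$-a.e. $\omega$ the sequence $\{P^{(n)}_{\sigma^{-n}\omega}1_X\}_n$ is uniformly integrable: for every $\varepsilon>0$ there is $\delta>0$ such that $m(A)<\delta$ implies $\int_A |P^{(n)}_{\sigma^{-n}\omega}1_X|\,dm<\varepsilon$ for all $n$; (b) for $\mathbb P$-a.e. $\omega$ the set $\{P^{(n)}_{\sigma^{-n}\omega}1_X\}_n$ is weakly precompact in $L^1(X,m)$: every sequence in it has a subsequence that converges weakly in $L^1(X,m)$; (c) there is a random invariant density, i.e. a (strongly) measurable map $h:\Omega\to L^1(X,m)$ such that for $\mathbb P$-a.e. $\omega$ one has $h_\omega\ge0$, $\|h_\omega\|_{L^1}=1$ and $P_\omega h_\omega=h_{\sigma\omega}$; moreover $h$ can be chosen so that, regarded as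 a measurable function $h(\omega,x)=h_\omega(x)$ on $\Omega\times X$, $\mathscr P^{*n}1_{\operatorname{supp}h}$ tends monotonically to $1$ as $n\to\infty$, $\mathbb P\times m$-a.e., where $\operatorname{supp}h=\{h\ne0\}$, $(\mathscr P\varphi)_\omega=P_{\sigma^{-1}\omega}\varphi_{\sigma^{-1}\omega}$ is the lift operator and $(\mathscr P^*g)(\omega,x)=g(\sigma\omega,T_\omega x)$ is its adjoint on $L^\infty(\Omega\times X,\mathbb P\times m)$. -/

import Mathlib

open MeasureTheory Filter Topology Set

noncomputable section

namespace RandomFibered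

/-- The cocycle `φ^{(n)}_ω = φ_{σ^{n-1} ω} ∘ ⋯ ∘ φ_{σ ω} ∘ φ_ω` generated over `σ` by a family of
self-maps `φ_ω` of `S`. It is used both for point maps (`S = X`) and for operators
(`S = L¹(X, m)`). -/
def cocycle {Ω S : Type*} (σ : Ω → Ω) (φ : Ω → S → S) : ℕ → Ω → S → S
  | 0, _ => id
  | n + 1, ω => φ (σ^[n] ω) ∘ cocycle σ φ n ω

section Operators

variable {X : Type*} [MeasurableSpace X]

/-- The Perron--Frobenius operator of `T` on `L¹(X, m)`: `𝓛_T f` is the Radon--Nikodym derivative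
with respect to `m` of the image under `T` of the signed measure `f m`. -/
def transferOp (m : Measure X) (T : X → X) (f : Lp ℝ 1 m) : Lp ℝ 1 m :=
  (SignedMeasure.integrable_rnDeriv ((m.withDensityᵥ (f : X → ℝ)).map T) m).toL1 _

/-- `∫_A 𝓛_T f dm = ∫_{T⁻¹ A} f dm` for a non-singular `T`. -/
theorem setIntegral_transferOp (m : Measure X) [IsProbabilityMeasure m] {T : X → X}
    (hT : Measure.QuasiMeasurePreserving T m m) (f : Lp ℝ 1 m) {A : Set X}
    (hA : MeasurableSet A) :
    ∫ x in A, transferOp m T f x ∂m = ∫ x in T ⁻¹' A, f x ∂m := by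
  have hf : Integrable (f : X → ℝ) m := L1.integrable_coeFn f
  set s := (m.withDensityᵥ (f : X → ℝ)).map T with hs
  have hac : VectorMeasure.AbsolutelyContinuous s m.toENNRealVectorMeasure := by
    refine VectorMeasure.AbsolutelyContinuous.mk fun B hB h0 => ?_
    rw [Measure.toENNRealVectorMeasure_apply_measurable hB] at h0
    rw [hs, VectorMeasure.map_apply _ hT.measurable hB,
      withDensityᵥ_apply hf (hT.measurable hB)]
    exact setIntegral_measure_zero _ (hT.preimage_null h0)
  have h1 := SignedMeasure.withDensityᵥ_rnDeriv_eq s m hac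
  have h2 : ∫ x in A, transferOp m T f x ∂m = ∫ x in A, SignedMeasure.rnDeriv s m x ∂m :=
    integral_congr_ae (ae_restrict_of_ae (Integrable.coeFn_toL1 _))
  rw [h2, ← withDensityᵥ_apply (SignedMeasure.integrable_rnDeriv s m) hA, h1, hs,
    VectorMeasure.map_apply _ hT.measurable hA, withDensityᵥ_apply hf (hT.measurable hA)]

/-- The duality `∫ (𝓛_T f) g dm = ∫ f (g ∘ T) dm`, which characterises the Perron--Frobenius
operator of a non-singular `T`. -/
theorem integral_transferOp_mul (m : Measure X) [IsProbabilityMeasure m] {T : X → X}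
    (hT : Measure.QuasiMeasurePreserving T m m) (f : Lp ℝ 1 m) {g : X → ℝ}
    (hg : Measurable g) {M : ℝ} (hM : ∀ x, |g x| ≤ M) :
    ∫ x, transferOp m T f x * g x ∂m = ∫ x, f x * g (T x) ∂m := by
  have hf : Integrable (f : X → ℝ) m := L1.integrable_coeFn f
  have hPf : Integrable (transferOp m T f : X → ℝ) m := L1.integrable_coeFn _
  have key : ∀ u : SimpleFunc X ℝ,
      ∫ x, transferOp m T f x * u x ∂m = ∫ x, f x * u (T x) ∂m := by
    intro u
    induction u using SimpleFunc.induction with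
    | const c hs =>
      rename_i s
      have e1 : ∀ x, transferOp m T f x * (SimpleFunc.piecewise s hs (SimpleFunc.const X c)
          (SimpleFunc.const X 0)) x = s.indicator (fun x => transferOp m T f x * c) x := by
        intro x; by_cases hx : x ∈ s <;> simp [hx]
      have e2 : ∀ x, f x * (SimpleFunc.piecewise s hs (SimpleFunc.const X c)
          (SimpleFunc.const X 0)) (T x) = (T ⁻¹' s).indicator (fun x => f x * c) x := by
        intro x; by_cases hx : T x ∈ s <;> simp [hx]
      simp_rw [e1, e2]
      rw [integral_indicator hs, integral_indicator (hT.measurable hs), integral_mul_const,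
        integral_mul_const, setIntegral_transferOp m hT f hs]
    | add hd hu hv =>
      rename_i u v
      have b : ∀ w : SimpleFunc X ℝ, ∃ c, ∀ x, ‖w x‖ ≤ c := fun w => w.exists_forall_norm_le
      obtain ⟨c, hc⟩ := b u
      obtain ⟨d, hd'⟩ := b v
      simp only [SimpleFunc.coe_add, Pi.add_apply, mul_add]
      rw [integral_add, integral_add, hu, hv]
      · exact hf.mul_bdd (c := c) ((u.measurable.comp hT.measurable).aestronglyMeasurable)
          (ae_of_all _ fun x => hc _)
      · exact hf.mul_bdd (c := d) ((v.measurable.comp hT.measurable).aestronglyMeasurable)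
          (ae_of_all _ fun x => hd' _)
      · exact hPf.mul_bdd (c := c) u.measurable.aestronglyMeasurable (ae_of_all _ fun x => hc _)
      · exact hPf.mul_bdd (c := d) v.measurable.aestronglyMeasurable (ae_of_all _ fun x => hd' _)
  have hsm := hg.stronglyMeasurable
  have hM' : ∀ x, ‖g x‖ ≤ M := hM
  have lim : ∀ (F : X → ℝ) (S : X → X), Integrable F m → Measurable S →
      Tendsto (fun n => ∫ x, F x * hsm.approxBounded M n (S x) ∂m) atTop
        (𝓝 (∫ x, F x * g (S x) ∂m)) := by
    intro F S hF hS
    refine tendsto_integral_of_dominated_convergence (fun x => ‖F x‖ * |M|) ?_ ?_ ?_ ?_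
    · intro n
      exact hF.aestronglyMeasurable.mul
        (((hsm.approxBounded M n).measurable.comp hS).aestronglyMeasurable)
    · exact hF.norm.mul_const _
    · intro n
      refine ae_of_all _ fun x => ?_
      have hM0 : 0 ≤ M := (norm_nonneg _).trans (hM' x)
      rw [norm_mul]
      gcongr
      exact (hsm.norm_approxBounded_le hM0 n (S x)).trans (le_abs_self M)
    · refine ae_of_all _ fun x => ?_
      exact (hsm.tendsto_approxBounded_of_norm_le (hM' (S x))).const_mul (F x)
  refine tendsto_nhds_unique (lim _ id hPf measurable_id) ?_
  simp only [id, key]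
  exact lim _ T hf hT.measurable

/-- The constant function `1_X` as an element of `L¹(X, m)`. -/
def oneL1 (m : Measure X) [IsProbabilityMeasure m] : Lp ℝ 1 m := Lp.const 1 m (1 : ℝ)

/-- `D(X, m)`: the densities, i.e. the `f ∈ L¹(X, m)` with `f ≥ 0` a.e. and `‖f‖ = 1`. -/
def densities (m : Measure X) : Set (Lp ℝ 1 m) := {f | 0 ≤ f ∧ ‖f‖ = 1}

/-- Uniform integrability of a sequence in `L¹(X, m)`. -/
def UniformlyIntegrableSeq (m : Measure X) (u : ℕ → Lp ℝ 1 m) : Prop :=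
  ∀ ε : ℝ, 0 < ε → ∃ δ : ℝ, 0 < δ ∧ ∀ A : Set X, MeasurableSet A → m.real A < δ →
    ∀ n, ∫ x in A, ‖u n x‖ ∂m < ε

end Operators

/-- A set `F` in a Banach space is weakly precompact if every sequence in `F` has a subsequence
that converges weakly in the space. -/
def WeaklyPrecompact {E : Type*} [NormedAddCommGroup E] [NormedSpace ℝ E] (F : Set E) : Prop :=
  ∀ u : ℕ → E, (∀ n, u n ∈ F) → ∃ (k : ℕ → ℕ) (g : E), StrictMono k ∧
    Tendsto (fun j => toWeakSpace ℝ E (u (k j))) atTop (𝓝 (toWeakSpace ℝ E g))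

section Systems

variable {Ω X I : Type*} [MeasurableSpace Ω] [MeasurableSpace X]

/-- `P^{(n)}_{σ^{-n} ω} 1_X`, where `P_ω` is the Perron--Frobenius operator of `T_ω`. -/
def pushedOne (m : Measure X) [IsProbabilityMeasure m] (σ : Ω ≃ᵐ Ω) (T : Ω → X → X) (ω : Ω)
    (n : ℕ) : Lp ℝ 1 m :=
  cocycle σ (fun ω => transferOp m (T ω)) n (σ.symm^[n] ω) (oneL1 m)

/-- `T^{(n)}_{σ^{-n} ω} = T_{σ^{-1} ω} ∘ ⋯ ∘ T_{σ^{-n} ω}`. -/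
def pastMap (σ : Ω ≃ᵐ Ω) (T : Ω → X → X) (ω : Ω) (n : ℕ) : X → X :=
  cocycle σ T n (σ.symm^[n] ω)

/-- `(X_i)` is a partition of `X` into measurable sets, up to `m`-null sets. -/
structure IsPartitionModNull (m : Measure X) (Y : I → Set X) : Prop where
  measurableSet : ∀ i, MeasurableSet (Y i)
  disjoint : ∀ i j, i ≠ j → m (Y i ∩ Y j) = 0
  cover : m (⋃ i, Y i)ᶜ = 0

/-- The cylinder
`X^ω_{i_1 … i_n} = X_{i_1} ∩ T_{σ^{-n}ω}^{-1} X_{i_2} ∩ ⋯ ∩ (T^{(n-1)}_{σ^{-n}ω})^{-1} X_{i_n}`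
(the word is indexed from `0`). -/
def cylinder (σ : Ω ≃ᵐ Ω) (T : Ω → X → X) (Y : I → Set X) (ω : Ω) (n : ℕ) (i : Fin n → I) :
    Set X :=
  ⋂ k : Fin n, cocycle σ T (k : ℕ) (σ.symm^[n] ω) ⁻¹' Y (i k)

/-- Generator condition: for a.e. `ω` the `σ`-algebra generated by all cylinders
`X^ω_{i_1 … i_n}`, `n ≥ 1`, is the whole `σ`-algebra of `X` modulo `m`-null sets. -/
def GeneratorCondition (ℙ : Measure Ω) (m : Measure X) (σ : Ω ≃ᵐ Ω) (T : Ω → X → X)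
    (Y : I → Set X) : Prop :=
  ∀ᵐ ω ∂ℙ, ∀ A : Set X, MeasurableSet A → ∃ B : Set X,
    MeasurableSet[MeasurableSpace.generateFrom
      {S : Set X | ∃ n : ℕ, 1 ≤ n ∧ ∃ i : Fin n → I, S = cylinder σ T Y ω n i}] B ∧ A =ᵐ[m] B

/-- The measure `m ∘ V`, where `V : F '' Z → Z` is the inverse of `F` restricted to a set `Z` on
which `F` is injective: `(m ∘ V)(E) = m (V (E ∩ F '' Z)) = m (Z ∩ F⁻¹ E)`. -/
def compLocalInverse (m : Measure X) (F : X → X) (Z : Set X) : Measure X :=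
  (m.restrict Z).map F

theorem compLocalInverse_apply (m : Measure X) {F V : X → X} {Z E : Set X} (hF : Measurable F)
    (hinj : InjOn F Z) (hV : ∀ y ∈ F '' Z, V y ∈ Z ∧ F (V y) = y) (hE : MeasurableSet E)
    (hEZ : E ⊆ F '' Z) : compLocalInverse m F Z E = m (V '' E) := by
  rw [compLocalInverse, Measure.map_apply hF hE, Measure.restrict_apply (hF hE)]
  congr 1
  ext x
  constructor
  · rintro ⟨hx, hxZ⟩
    have h := hV (F x) ⟨x, hxZ, rfl⟩
    exact ⟨F x, hx, hinj h.1 hxZ h.2⟩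
  · rintro ⟨y, hy, rfl⟩
    have h := hV y (hEZ hy)
    exact ⟨by simpa [h.2] using hy, h.1⟩

/-- The Jacobian `d(m ∘ V^ω_{i_1 … i_n}) / dm`, where `V^ω_{i_1 … i_n}` is the inverse of
`T^{(n)}_{σ^{-n} ω}` restricted to the cylinder `X^ω_{i_1 … i_n}`. -/
def jacobian (m : Measure X) (σ : Ω ≃ᵐ Ω) (T : Ω → X → X) (Y : I → Set X) (ω : Ω) (n : ℕ)
    (i : Fin n → I) : X → ENNReal :=
  (compLocalInverse m (pastMap σ T ω n) (cylinder σ T Y ω n i)).rnDeriv m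

/-- The image `T^{(n)}_{σ^{-n} ω} X^ω_{i_1 … i_n}`. -/
def cylinderImage (σ : Ω ≃ᵐ Ω) (T : Ω → X → X) (Y : I → Set X) (ω : Ω) (n : ℕ)
    (i : Fin n → I) : Set X :=
  pastMap σ T ω n '' cylinder σ T Y ω n i

/-- Bounded distortion, required for the cylinders that are non-empty modulo `m`. -/
def BoundedDistortion (ℙ : Measure Ω) (m : Measure X) (σ : Ω ≃ᵐ Ω) (T : Ω → X → X)
    (Y : I → Set X) : Prop :=
  ∃ C : ℝ, 1 ≤ C ∧ ∀ᵐ ω ∂ℙ, ∀ n : ℕ, 1 ≤ n → ∀ i : Fin n → I, 0 < m (cylinder σ T Y ω n i) →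
    essSup (jacobian m σ T Y ω n i) (m.restrict (cylinderImage σ T Y ω n i)) ≤
      ENNReal.ofReal C *
        essInf (jacobian m σ T Y ω n i) (m.restrict (cylinderImage σ T Y ω n i))

/-- Uniform lower bound for the measures of the images of the cylinders that are non-empty
modulo `m`. -/
def LargeImages (ℙ : Measure Ω) (m : Measure X) (σ : Ω ≃ᵐ Ω) (T : Ω → X → X)
    (Y : I → Set X) : Prop :=
  ∃ c : ℝ, 0 < c ∧ ∀ᵐ ω ∂ℙ, ∀ n : ℕ, 1 ≤ n → ∀ i : Fin n → I, 0 < m (cylinder σ T Y ω n i) →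
    ENNReal.ofReal c < m (cylinderImage σ T Y ω n i)

/-- `h` is a random invariant density for the operators `P_ω` over `σ`: a strongly measurable map
`Ω → L¹(X, m)` with `h_ω ∈ D(X, m)` and `P_ω h_ω = h_{σ ω}` for a.e. `ω`. -/
def IsRandomInvariantDensity (ℙ : Measure Ω) (m : Measure X) (σ : Ω ≃ᵐ Ω)
    (P : Ω → Lp ℝ 1 m → Lp ℝ 1 m) (h : Ω → Lp ℝ 1 m) : Prop :=
  StronglyMeasurable h ∧ ∀ᵐ ω ∂ℙ, h ω ∈ densities m ∧ P ω (h ω) = h (σ ω)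

/-- The lift operator `(𝒫 φ)_ω = P_{σ^{-1} ω} φ_{σ^{-1} ω}`. -/
def liftOp (m : Measure X) (σ : Ω ≃ᵐ Ω) (P : Ω → Lp ℝ 1 m → Lp ℝ 1 m) (φ : Ω → Lp ℝ 1 m) :
    Ω → Lp ℝ 1 m :=
  fun ω => P (σ.symm ω) (φ (σ.symm ω))

/-- The adjoint `𝒫^*`, acting on bounded measurable functions on `Ω × X`, of the lift operator of
the Perron--Frobenius operators of `T_ω`: `(𝒫^* g)(ω, x) = g (σ ω, T_ω x)`. -/
def liftAdjoint (σ : Ω ≃ᵐ Ω) (T : Ω → X → X) (g : Ω × X → ℝ) : Ω × X → ℝ :=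
  fun z => g (σ z.1, T z.1 z.2)

/-- `liftAdjoint` is the adjoint of the lift operator. -/
theorem integral_liftOp_mul (ℙ : Measure Ω) (m : Measure X) [IsProbabilityMeasure m]
    (σ : Ω ≃ᵐ Ω) (hσ : MeasurePreserving σ ℙ ℙ) (T : Ω → X → X)
    (hT : ∀ ω, Measure.QuasiMeasurePreserving (T ω) m m) (φ : Ω → Lp ℝ 1 m) {g : Ω × X → ℝ}
    (hg : Measurable g) {M : ℝ} (hM : ∀ z, |g z| ≤ M) :
    ∫ ω, ∫ x, liftOp m σ (fun ω => transferOp m (T ω)) φ ω x * g (ω, x) ∂m ∂ℙ =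
      ∫ ω, ∫ x, φ ω x * liftAdjoint σ T g (ω, x) ∂m ∂ℙ := by
  rw [← hσ.integral_comp σ.measurableEmbedding]
  refine integral_congr_ae (ae_of_all _ fun ω => ?_)
  simp only [liftOp, liftAdjoint, MeasurableEquiv.symm_apply_apply]
  exact integral_transferOp_mul m (hT ω) (φ ω) (g := fun x => g (σ ω, x))
    (hg.comp measurable_prodMk_left) fun x => hM _

/-- `𝒫^{*n} 1_{supp h}` tends monotonically to `1` almost everywhere on `Ω × X`, where `h` is
regarded as a measurable function on `Ω × X` through `h (ω, x) = h_ω (x)`. -/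
def SupportSweepsOut (ℙ : Measure Ω) (m : Measure X) (σ : Ω ≃ᵐ Ω) (T : Ω → X → X)
    (h : Ω → Lp ℝ 1 m) : Prop :=
  ∃ H : Ω × X → ℝ, Measurable H ∧ (∀ᵐ ω ∂ℙ, (fun x => H (ω, x)) =ᵐ[m] h ω) ∧
    ∀ᵐ z ∂(ℙ.prod m),
      Monotone (fun n : ℕ =>
        (liftAdjoint σ T)^[n] ((Function.support H).indicator fun _ => 1) z) ∧
      Tendsto (fun n : ℕ =>
        (liftAdjoint σ T)^[n] ((Function.support H).indicator fun _ => 1) z) atTop (𝓝 1)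

end Systems

end RandomFibered

end

open RandomFibered

/-!
The point is a uniform bound in `L^∞`: there is a constant `K` such that, for almost every `ω`,
`0 ≤ P^{(n)}_{σ^{-n} ω} 1 ≤ K` for all `n`, or equivalently
`m ((T^{(n)}_{σ^{-n} ω})⁻¹ A) ≤ K m(A)` for all measurable `A`. Indeed `P^{(n)}_{σ^{-n} ω} 1` is the
sum over the cylinders `Z` of rank `n` of the Jacobians `J` of the inverse branches. Each `J` lives
on the image of `Z`, where bounded distortion gives `J ≤ C ess inf J`; since `J` integrates to
`m(Z)` over a set of measure at least `c`, `J ≤ (C / c) m(Z)`, and the measures of the cylinders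
sum to `1`. This is `measure_inter_preimage_le_of_distortion` and
`exists_measure_pastMap_preimage_le`.

Uniform integrability is then immediate, and weak precompactness in `L¹` follows from weak
sequential compactness of balls in the Hilbert space `L²` (`weaklyPrecompact_setOf_ae_abs_le`).

For the invariant density, consider the skew product `Θ (ω, x) = (σ ω, T_ω x)` on `Ω × X`. As `σ`
preserves `ℙ`, the bound on the fibres turns into `μ (Θ⁻ⁿ A) ≤ K μ(A)` for `μ = ℙ × m`. A weak limit
`H` in `L¹(μ)` of the Cesàro averages of the densities of the images of `μ` is the density of a
`Θ`-invariant measure `ν`, and `ν(A) = μ(A)` for every `A` with `μ (Θ⁻ⁿ A) = μ(A)` for all `n`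
(`exists_bounded_invariant_density`). Applied to `A = B × X` this gives `∫ H (ω, x) dm(x) = 1` for
almost every `ω`, and disintegrating the invariance of `ν` gives `P_ω h_ω = h_{σ ω}` for
`h_ω = H (ω, ·)` (`ae_map_withDensity_eq`). Finally the support of `H` is forward invariant modulo
`μ`, and the set `D` of the points whose orbit never meets it is invariant, so that
`μ(D) = ν(D) = 0` (`ae_monotone_and_tendsto_indicator_support`).
-/

open scoped ENNReal

namespace RandomFibered

/-! ### Weak precompactness of order-bounded sets in `L¹` -/

/-- The inclusion `L² ⊆ L¹` over a probability space, as a continuous linear map. -/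
noncomputable def l2ToL1 {α : Type*} [MeasurableSpace α] (μ : Measure α) [IsProbabilityMeasure μ] :
    Lp ℝ 2 μ →L[ℝ] Lp ℝ 1 μ :=
  LinearMap.mkContinuous
    { toFun := fun f => ⟨f, Lp.antitone (by norm_num) f.2⟩
      map_add' := fun _ _ => rfl
      map_smul' := fun _ _ => rfl } 1 fun f => by
    rw [one_mul, Lp.norm_def, Lp.norm_def]
    exact ENNReal.toReal_mono (Lp.eLpNorm_ne_top f)
      (eLpNorm_le_eLpNorm_of_exponent_le (by norm_num) (Lp.aestronglyMeasurable f))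

theorem coeFn_l2ToL1 {α : Type*} [MeasurableSpace α] (μ : Measure α) [IsProbabilityMeasure μ]
    (f : Lp ℝ 2 μ) : (l2ToL1 μ f : α → ℝ) = f := rfl

/-- Order-bounded sets in `L¹` are weakly precompact. They are images of bounded sets under the
inclusion `L² → L¹`, and bounded sequences in the separable Hilbert space `L²` have weakly
convergent subsequences. -/
theorem weaklyPrecompact_setOf_ae_abs_le {α : Type*} [MeasurableSpace α]
    [MeasurableSpace.CountablyGenerated α] (μ : Measure α) [IsProbabilityMeasure μ] (K : ℝ) :
    WeaklyPrecompact {u : Lp ℝ 1 μ | ∀ᵐ x ∂μ, |u x| ≤ K} := by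
  intro u hu
  have hmem : ∀ n, MemLp (u n) 2 μ := fun n =>
    (MemLp.of_bound (p := 2) (Lp.aestronglyMeasurable (u n)) K (hu n))
  set v : ℕ → Lp ℝ 2 μ := fun n => (hmem n).toLp
  have hvu : ∀ n, l2ToL1 μ (v n) = u n := fun n => Lp.ext (by
    rw [coeFn_l2ToL1]; exact (hmem n).coeFn_toLp)
  have hvK : ∀ n, ‖v n‖ ≤ |K| := by
    intro n
    have h := Lp.norm_le_of_ae_bound (f := v n) (abs_nonneg K) (by
      filter_upwards [(hmem n).coeFn_toLp, hu n] with x hx hx'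
      rw [show v n x = u n x from hx]
      exact hx'.trans (le_abs_self K))
    simpa [measureUnivNNReal] using h
  have : Fact ((2 : ENNReal) ≠ ⊤) := ⟨by norm_num⟩
  obtain ⟨φ, -, k, hk, hlim⟩ := WeakDual.isSeqCompact_closedBall ℝ (Lp ℝ 2 μ) 0 |K|
    (x := fun n => StrongDual.toWeakDual (InnerProductSpace.toDual ℝ (Lp ℝ 2 μ) (v n)))
    (fun n => by
      rw [mem_preimage, mem_closedBall_zero_iff]
      exact ((InnerProductSpace.toDual ℝ (Lp ℝ 2 μ)).norm_map (v n)).trans_le (hvK n))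
  rw [tendsto_iff_forall_eval_tendsto_topDualPairing] at hlim
  set g := (InnerProductSpace.toDual ℝ (Lp ℝ 2 μ)).symm (WeakDual.toStrongDual φ)
  refine ⟨k, l2ToL1 μ g, hk, ?_⟩
  have hind : Topology.IsInducing fun (x : WeakSpace ℝ (Lp ℝ 1 μ)) (l : StrongDual ℝ (Lp ℝ 1 μ)) =>
      (topDualPairing ℝ (Lp ℝ 1 μ)).flip x l := ⟨rfl⟩
  refine hind.tendsto_nhds_iff.2 (tendsto_pi_nhds.2 fun l => ?_)
  set w := (InnerProductSpace.toDual ℝ (Lp ℝ 2 μ)).symm (l.comp (l2ToL1 μ))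
  have hw : ∀ f, l (l2ToL1 μ f) = inner ℝ f w := fun f => by
    rw [real_inner_comm, InnerProductSpace.toDual_symm_apply]; rfl
  have h := hlim w
  have hg : φ w = inner ℝ g w := by
    rw [InnerProductSpace.toDual_symm_apply]; rfl
  change Tendsto (fun j => inner ℝ (v (k j)) w) atTop (𝓝 (φ w)) at h
  change Tendsto (fun j => l (u (k j))) atTop (𝓝 (l (l2ToL1 μ g)))
  simp only [← hvu, hw]
  rwa [hg] at h

/-! ### Densities determined by their integrals over sets -/

section Bounds

variable {X : Type*} [MeasurableSpace X]

theorem ae_mem_Icc_of_setIntegral {m : Measure X} [IsFiniteMeasure m] {K : ℝ} (f : Lp ℝ 1 m)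
    (h0 : ∀ A, MeasurableSet A → 0 ≤ ∫ x in A, f x ∂m)
    (hK : ∀ A, MeasurableSet A → ∫ x in A, f x ∂m ≤ K * m.real A) :
    ∀ᵐ x ∂m, f x ∈ Icc 0 K := by
  have hi : Integrable f m := L1.integrable_coeFn _
  have h1 : 0 ≤ᵐ[m] f := ae_nonneg_of_forall_setIntegral_nonneg hi fun A hA _ => h0 A hA
  have h2 : f ≤ᵐ[m] fun _ => K :=
    ae_le_of_forall_setIntegral_le hi (integrable_const K) fun A hA _ => by
      rw [setIntegral_const, smul_eq_mul, mul_comm]; exact hK A hA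
  filter_upwards [h1, h2] with x h1 h2 using ⟨h1, h2⟩

theorem measureReal_le_mul_of_measure_le {m : Measure X} [IsFiniteMeasure m] {K : ℝ} (hK : 0 ≤ K)
    {A B : Set X} (h : m B ≤ ENNReal.ofReal K * m A) : m.real B ≤ K * m.real A := by
  have := ENNReal.toReal_mono (ENNReal.mul_ne_top ENNReal.ofReal_ne_top (measure_ne_top m A)) h
  rwa [ENNReal.toReal_mul, ENNReal.toReal_ofReal hK] at this

end Bounds

/-! ### Distortion of the inverse branches -/

section Distortion

variable {X : Type*} [MeasurableSpace X]

/-- Bounded distortion and a large image make the preimages of small sets under a branch small: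
the Jacobian `J` of the inverse branch satisfies `J ≤ C · ess inf J` on the image `F '' Z`, and
`ess inf J · m (F '' Z) ≤ m Z`. The image need not be measurable, because `m ∘ V` vanishes off its
measurable hull. -/
theorem measure_inter_preimage_le_of_distortion (m : Measure X) [IsProbabilityMeasure m]
    {F : X → X} (hF : Measure.QuasiMeasurePreserving F m m) {Z : Set X} {C c : ℝ≥0∞}
    (hc : c ≠ 0)
    (hdist : essSup ((compLocalInverse m F Z).rnDeriv m) (m.restrict (F '' Z)) ≤
      C * essInf ((compLocalInverse m F Z).rnDeriv m) (m.restrict (F '' Z)))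
    (himg : c ≤ m (F '' Z)) {A : Set X} (hA : MeasurableSet A) :
    m (F ⁻¹' A ∩ Z) ≤ C * (m Z / c) * m A := by
  set ν := compLocalInverse m F Z with hν
  set J := ν.rnDeriv m
  set S := toMeasurable m (F '' Z)
  have : IsFiniteMeasure ν := by rw [hν, compLocalInverse]; infer_instance
  have hSm : MeasurableSet S := measurableSet_toMeasurable _ _
  have hνap : ∀ B, MeasurableSet B → ν B = m (F ⁻¹' B ∩ Z) := fun B hB => by
    rw [hν, compLocalInverse, Measure.map_apply hF.measurable hB,
      Measure.restrict_apply (hF.measurable hB)]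
  have hac : ν ≪ m := Measure.AbsolutelyContinuous.mk fun B hB h0 => by
    rw [hνap B hB]
    exact measure_mono_null inter_subset_left (hF.preimage_null h0)
  have hS0 : ν Sᶜ = 0 := by
    rw [hνap _ hSm.compl]
    convert measure_empty (μ := m)
    ext x
    simp only [mem_inter_iff, mem_preimage, mem_compl_iff, mem_empty_iff_false, iff_false]
    exact fun h => h.1 (subset_toMeasurable _ _ (mem_image_of_mem F h.2))
  have hres : m.restrict S = m.restrict (F '' Z) :=
    Measure.restrict_toMeasurable (measure_ne_top _ _)
  rw [← hres] at hdist
  have hinf : essInf J (m.restrict S) * c ≤ m Z := by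
    calc essInf J (m.restrict S) * c
        ≤ essInf J (m.restrict S) * m S := by
          gcongr
          exact himg.trans (measure_mono (subset_toMeasurable _ _))
      _ = ∫⁻ _ in S, essInf J (m.restrict S) ∂m := by simp
      _ ≤ ∫⁻ x in S, J x ∂m := lintegral_mono_ae ae_essInf_le
      _ ≤ ν S := Measure.setLIntegral_rnDeriv_le S
      _ ≤ m Z := by rw [hνap S hSm]; exact measure_mono inter_subset_right
  have hinf' : essInf J (m.restrict S) ≤ m Z / c := by
    rw [ENNReal.le_div_iff_mul_le (Or.inl hc)
      (Or.inl (himg.trans_lt (measure_lt_top _ _)).ne)]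
    exact hinf
  calc m (F ⁻¹' A ∩ Z) = ν A := (hνap A hA).symm
    _ = ν (A ∩ S) := by
        rw [measure_inter_conull hS0]
    _ = ∫⁻ x in A, J x ∂(m.restrict S) := by
        rw [Measure.restrict_restrict hA, Measure.setLIntegral_rnDeriv hac]
    _ ≤ ∫⁻ _ in A, C * (m Z / c) ∂(m.restrict S) := by
        refine lintegral_mono_ae (ae_restrict_of_ae ?_)
        filter_upwards [ae_le_essSup (μ := m.restrict S) (f := J)] with x hx
        exact hx.trans (hdist.trans (by gcongr))
    _ = C * (m Z / c) * m (A ∩ S) := by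
        rw [setLIntegral_const, Measure.restrict_apply hA]
    _ ≤ C * (m Z / c) * m A := by gcongr; exact inter_subset_left

end Distortion

/-! ### Iterates along the past -/

section Cocycle

variable {Ω X I : Type*} [MeasurableSpace X]

theorem quasiMeasurePreserving_cocycle {m : Measure X} {σ : Ω → Ω} {T : Ω → X → X}
    (hT : ∀ ω, Measure.QuasiMeasurePreserving (T ω) m m) (n : ℕ) (ω : Ω) :
    Measure.QuasiMeasurePreserving (cocycle σ T n ω) m m := by
  induction n with
  | zero => exact Measure.QuasiMeasurePreserving.id m
  | succ n ih => exact (hT _).comp ih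

/-- `∫_A P^{(n)}_ω f dm = ∫_{(T^{(n)}_ω)⁻¹ A} f dm`. -/
theorem setIntegral_cocycle_transferOp {m : Measure X} [IsProbabilityMeasure m] {σ : Ω → Ω}
    {T : Ω → X → X} (hT : ∀ ω, Measure.QuasiMeasurePreserving (T ω) m m) (f : Lp ℝ 1 m) (n : ℕ)
    (ω : Ω) {A : Set X} (hA : MeasurableSet A) :
    ∫ x in A, cocycle σ (fun ω => transferOp m (T ω)) n ω f x ∂m =
      ∫ x in cocycle σ T n ω ⁻¹' A, f x ∂m := by
  induction n generalizing A with
  | zero => rfl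
  | succ n ih =>
    change ∫ x in A, transferOp m (T (σ^[n] ω)) (cocycle σ _ n ω f) x ∂m = _
    rw [setIntegral_transferOp m (hT _) _ hA, ih ((hT _).measurable hA)]
    rfl

variable [MeasurableSpace Ω]

theorem measure_compl_iUnion_cylinder {m : Measure X} {σ : Ω ≃ᵐ Ω} {T : Ω → X → X}
    (hT : ∀ ω, Measure.QuasiMeasurePreserving (T ω) m m) {Y : I → Set X}
    (hY : IsPartitionModNull m Y) (ω : Ω) (n : ℕ) :
    m (⋃ i, cylinder σ T Y ω n i)ᶜ = 0 := by
  refine measure_mono_null (t := ⋃ k : Fin n,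
    cocycle σ T (k : ℕ) (σ.symm^[n] ω) ⁻¹' (⋃ i, Y i)ᶜ) (fun x hx => ?_)
    (measure_iUnion_null fun k => (quasiMeasurePreserving_cocycle hT _ _).preimage_null hY.cover)
  by_contra h
  simp only [mem_iUnion, mem_preimage, mem_compl_iff, not_exists, not_not, not_forall] at h
  choose i hi using h
  exact hx (mem_iUnion.2 ⟨i, mem_iInter.2 hi⟩)

theorem aedisjoint_cylinder {m : Measure X} {σ : Ω ≃ᵐ Ω} {T : Ω → X → X}
    (hT : ∀ ω, Measure.QuasiMeasurePreserving (T ω) m m) {Y : I → Set X}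
    (hY : IsPartitionModNull m Y) (ω : Ω) (n : ℕ) :
    Pairwise (Function.onFun (AEDisjoint m) (cylinder σ T Y ω n)) := by
  intro i j hij
  obtain ⟨k, hk⟩ := Function.ne_iff.1 hij
  exact measure_mono_null
    (t := cocycle σ T (k : ℕ) (σ.symm^[n] ω) ⁻¹' (Y (i k) ∩ Y (j k)))
    (fun x hx => ⟨mem_iInter.1 hx.1 k, mem_iInter.1 hx.2 k⟩)
    ((quasiMeasurePreserving_cocycle hT k (σ.symm^[n] ω)).preimage_null (hY.disjoint _ _ hk))

theorem measurableSet_cylinder {m : Measure X} {σ : Ω ≃ᵐ Ω} {T : Ω → X → X}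
    (hT : ∀ ω, Measure.QuasiMeasurePreserving (T ω) m m) {Y : I → Set X}
    (hY : IsPartitionModNull m Y) (ω : Ω) (n : ℕ) (i : Fin n → I) :
    MeasurableSet (cylinder σ T Y ω n i) :=
  MeasurableSet.iInter fun _ =>
    (quasiMeasurePreserving_cocycle hT _ _).measurable (hY.measurableSet _)

/-- The iterates from the past distort measures by at most a constant, uniformly in their number:
`m ((T^{(n)}_{σ^{-n} ω})⁻¹ A) ≤ K m(A)`. This sums `measure_inter_preimage_le_of_distortion` over
the cylinders of rank `n`. -/
theorem exists_measure_pastMap_preimage_le [Countable I] {ℙ : Measure Ω} {m : Measure X}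
    [IsProbabilityMeasure m] {σ : Ω ≃ᵐ Ω} {T : Ω → X → X}
    (hT : ∀ ω, Measure.QuasiMeasurePreserving (T ω) m m) {Y : I → Set X}
    (hY : IsPartitionModNull m Y) (hdist : BoundedDistortion ℙ m σ T Y)
    (himg : LargeImages ℙ m σ T Y) :
    ∃ K : ℝ, 0 ≤ K ∧ ∀ᵐ ω ∂ℙ, ∀ n : ℕ, ∀ A, MeasurableSet A →
      m (pastMap σ T ω n ⁻¹' A) ≤ ENNReal.ofReal K * m A := by
  obtain ⟨C, -, hC⟩ := hdist
  obtain ⟨c, hc, hcimg⟩ := himg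
  refine ⟨max 1 (C / c), by positivity, ?_⟩
  filter_upwards [hC, hcimg] with ω hC hcimg n A hA
  rcases Nat.eq_zero_or_pos n with rfl | hn
  · calc m (pastMap σ T ω 0 ⁻¹' A) = 1 * m A := by rw [one_mul]; rfl
      _ ≤ _ := by gcongr; simp
  have hq : Measure.QuasiMeasurePreserving (pastMap σ T ω n) m m :=
    quasiMeasurePreserving_cocycle hT _ _
  have hbr : ∀ i, m (pastMap σ T ω n ⁻¹' A ∩ cylinder σ T Y ω n i) ≤
      ENNReal.ofReal (C / c) * m (cylinder σ T Y ω n i) * m A := by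
    intro i
    rcases eq_or_ne (m (cylinder σ T Y ω n i)) 0 with h0 | h0
    · rw [measure_mono_null inter_subset_right h0]
      exact zero_le
    · have h := measure_inter_preimage_le_of_distortion m hq
        (ENNReal.ofReal_pos.2 hc).ne' (hC n hn i (pos_iff_ne_zero.2 h0))
        (hcimg n hn i (pos_iff_ne_zero.2 h0)).le hA
      refine h.trans_eq ?_
      rw [ENNReal.ofReal_div_of_pos hc, div_eq_mul_inv, div_eq_mul_inv]
      ring
  calc m (pastMap σ T ω n ⁻¹' A)
      ≤ m (⋃ i, pastMap σ T ω n ⁻¹' A ∩ cylinder σ T Y ω n i) := by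
        rw [← inter_iUnion, measure_inter_conull (measure_compl_iUnion_cylinder hT hY ω n)]
    _ ≤ ∑' i, m (pastMap σ T ω n ⁻¹' A ∩ cylinder σ T Y ω n i) := measure_iUnion_le _
    _ ≤ ∑' i, ENNReal.ofReal (C / c) * m (cylinder σ T Y ω n i) * m A :=
        ENNReal.tsum_le_tsum hbr
    _ = ENNReal.ofReal (C / c) * m (⋃ i, cylinder σ T Y ω n i) * m A := by
        rw [ENNReal.tsum_mul_right, ENNReal.tsum_mul_left,
          measure_iUnion₀ (aedisjoint_cylinder hT hY ω n)
            fun i => (measurableSet_cylinder hT hY ω n i).nullMeasurableSet]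
    _ ≤ ENNReal.ofReal (max 1 (C / c)) * 1 * m A := by
        gcongr
        · exact le_max_right _ _
        · exact prob_le_one
    _ = ENNReal.ofReal (max 1 (C / c)) * m A := by rw [mul_one]

theorem setIntegral_pushedOne {m : Measure X} [IsProbabilityMeasure m] {σ : Ω ≃ᵐ Ω}
    {T : Ω → X → X} (hT : ∀ ω, Measure.QuasiMeasurePreserving (T ω) m m) (ω : Ω) (n : ℕ)
    {A : Set X} (hA : MeasurableSet A) :
    ∫ x in A, pushedOne m σ T ω n x ∂m = m.real (pastMap σ T ω n ⁻¹' A) := by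
  rw [pushedOne, setIntegral_cocycle_transferOp hT _ _ _ hA,
    setIntegral_congr_ae (g := fun _ => (1 : ℝ))
      ((quasiMeasurePreserving_cocycle hT _ _).measurable hA)]
  · simp [pastMap]
  · filter_upwards [Lp.coeFn_const (p := 1) (μ := m) (1 : ℝ)] with x hx _
    exact hx

theorem ae_abs_pushedOne_le {m : Measure X} [IsProbabilityMeasure m] {σ : Ω ≃ᵐ Ω}
    {T : Ω → X → X} (hT : ∀ ω, Measure.QuasiMeasurePreserving (T ω) m m) {ω : Ω} {n : ℕ} {K : ℝ}
    (hK : 0 ≤ K) (h : ∀ A, MeasurableSet A →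
      m (pastMap σ T ω n ⁻¹' A) ≤ ENNReal.ofReal K * m A) :
    ∀ᵐ x ∂m, |pushedOne m σ T ω n x| ≤ K := by
  refine (ae_mem_Icc_of_setIntegral _ (fun A hA => ?_) fun A hA => ?_).mono
    fun x hx => (abs_of_nonneg hx.1).trans_le hx.2
  · rw [setIntegral_pushedOne hT ω n hA]
    exact measureReal_nonneg
  · rw [setIntegral_pushedOne hT ω n hA]
    exact measureReal_le_mul_of_measure_le hK (h A hA)

theorem uniformlyIntegrableSeq_of_ae_abs_le {m : Measure X} [IsProbabilityMeasure m]
    {u : ℕ → Lp ℝ 1 m} {K : ℝ} (hK : 0 ≤ K) (h : ∀ n, ∀ᵐ x ∂m, |u n x| ≤ K) :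
    UniformlyIntegrableSeq m u := by
  intro ε hε
  refine ⟨ε / (K + 1), by positivity, fun A _ hA n => ?_⟩
  calc ∫ x in A, ‖u n x‖ ∂m ≤ ∫ _ in A, K ∂m :=
        integral_mono_ae (L1.integrable_coeFn (u n)).norm.integrableOn (integrable_const K)
          (ae_restrict_of_ae (h n))
    _ = m.real A * K := by rw [setIntegral_const, smul_eq_mul]
    _ ≤ m.real A * (K + 1) := by gcongr; linarith
    _ < ε := by rwa [lt_div_iff₀ (by positivity)] at hA

end Cocycle

/-! ### Invariant measures of maps with uniformly bounded distortion -/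

section Invariant

variable {Z : Type*} [MeasurableSpace Z]

/-- `f ↦ ∫_A f dμ` as a continuous linear functional on `L¹`. -/
noncomputable def setIntegralL1 (μ : Measure Z) (A : Set Z) : Lp ℝ 1 μ →L[ℝ] ℝ where
  toFun f := ∫ z in A, f z ∂μ
  map_add' f g := by
    rw [← integral_add (L1.integrable_coeFn f).integrableOn (L1.integrable_coeFn g).integrableOn]
    exact integral_congr_ae (ae_restrict_of_ae (Lp.coeFn_add f g))
  map_smul' c f := by
    rw [RingHom.id_apply, ← integral_smul]
    exact integral_congr_ae (ae_restrict_of_ae (Lp.coeFn_smul c f))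
  cont := continuous_setIntegral A

theorem setIntegralL1_apply (μ : Measure Z) (A : Set Z) (f : Lp ℝ 1 μ) :
    setIntegralL1 μ A f = ∫ z in A, f z ∂μ := rfl

/-- A map whose iterates distort `μ` by at most a factor `K` has an invariant measure `ν = H μ`
with `H ≤ K`, which agrees with `μ` on all sets whose measure the iterates do not change. Here `H`
is a weak limit in `L¹(μ)` of the Cesàro averages of the densities of the iterated images of `μ`. -/
theorem exists_bounded_invariant_density [MeasurableSpace.CountablyGenerated Z] (μ : Measure Z)
    [IsProbabilityMeasure μ] {Θ : Z → Z} (hΘ : Measurable Θ) {K : ℝ} (hK : 0 ≤ K)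
    (hb : ∀ n A, MeasurableSet A → μ (Θ^[n] ⁻¹' A) ≤ ENNReal.ofReal K * μ A) :
    ∃ H : Z → ℝ, Measurable H ∧ (∀ z, H z ∈ Icc 0 K) ∧
      MeasurePreserving Θ (μ.withDensity fun z => ENNReal.ofReal (H z))
        (μ.withDensity fun z => ENNReal.ofReal (H z)) ∧
      ∀ A, MeasurableSet A → (∀ n, μ (Θ^[n] ⁻¹' A) = μ A) →
        μ.withDensity (fun z => ENNReal.ofReal (H z)) A = μ A := by
  have hq : ∀ n, Measure.QuasiMeasurePreserving (Θ^[n]) μ μ := fun n =>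
    ⟨hΘ.iterate n, Measure.AbsolutelyContinuous.mk fun A hA h0 => by
      rw [Measure.map_apply (hΘ.iterate n) hA, ← nonpos_iff_eq_zero]
      exact (hb n A hA).trans_eq (by rw [h0, mul_zero])⟩
  set a : ℕ → Set Z → ℝ := fun N A =>
    ((N : ℝ) + 1)⁻¹ * ∑ n ∈ Finset.range (N + 1), μ.real (Θ^[n] ⁻¹' A) with ha
  set U : ℕ → Lp ℝ 1 μ := fun N =>
    ((N : ℝ) + 1)⁻¹ • ∑ n ∈ Finset.range (N + 1), transferOp μ (Θ^[n]) (oneL1 μ) with hU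
  have hUint : ∀ N A, MeasurableSet A → ∫ z in A, U N z ∂μ = a N A := by
    intro N A hA
    rw [← setIntegralL1_apply, hU, ha]
    simp only [map_smul, map_sum, smul_eq_mul]
    congr 1
    refine Finset.sum_congr rfl fun n _ => ?_
    rw [setIntegralL1_apply, setIntegral_transferOp μ (hq n) _ hA,
      setIntegral_congr_ae (g := fun _ => (1 : ℝ)) ((hq n).measurable hA)]
    · simp
    · filter_upwards [Lp.coeFn_const (p := 1) (μ := μ) (1 : ℝ)] with x hx _
      exact hx
  have ha0 : ∀ N A, 0 ≤ a N A := fun N A =>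
    mul_nonneg (by positivity) (Finset.sum_nonneg fun n _ => measureReal_nonneg)
  have haK : ∀ N A, MeasurableSet A → a N A ≤ K * μ.real A := by
    intro N A hA
    rw [ha]
    simp only
    rw [inv_mul_le_iff₀ (by positivity)]
    calc ∑ n ∈ Finset.range (N + 1), μ.real (Θ^[n] ⁻¹' A)
        ≤ ∑ n ∈ Finset.range (N + 1), K * μ.real A :=
          Finset.sum_le_sum fun n _ => measureReal_le_mul_of_measure_le hK (hb n A hA)
      _ = (N + 1) * (K * μ.real A) := by simp
  obtain ⟨k, g, hk, hlim⟩ := weaklyPrecompact_setOf_ae_abs_le μ K U fun N => by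
    refine (ae_mem_Icc_of_setIntegral (U N) (fun A hA => ?_) fun A hA => ?_).mono
      fun x hx => (abs_of_nonneg hx.1).trans_le hx.2
    · rw [hUint N A hA]; exact ha0 N A
    · rw [hUint N A hA]; exact haK N A hA
  have hlimA : ∀ A, MeasurableSet A →
      Tendsto (fun j => a (k j) A) atTop (𝓝 (∫ z in A, g z ∂μ)) := by
    intro A hA
    have h := ((WeakBilin.eval_continuous (topDualPairing ℝ (Lp ℝ 1 μ)).flip
      (setIntegralL1 μ A)).tendsto _).comp hlim
    refine h.congr fun j => ?_
    exact hUint (k j) A hA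
  have hg := ae_mem_Icc_of_setIntegral (K := K) g
    (fun A hA => ge_of_tendsto' (hlimA A hA) fun j => ha0 _ A)
    (fun A hA => le_of_tendsto' (hlimA A hA) fun j => haK _ A hA)
  have hgm : Measurable (g : Z → ℝ) := (Lp.stronglyMeasurable g).measurable
  set H : Z → ℝ := fun z => max 0 (min K (g z)) with hH
  have hHm : Measurable H := measurable_const.max (measurable_const.min hgm)
  have hH0 : ∀ z, H z ∈ Icc 0 K := fun z => ⟨le_max_left _ _, max_le hK (min_le_left _ _)⟩
  have hHg : H =ᵐ[μ] g := hg.mono fun z hz => by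
    simp only [hH]; rw [min_eq_right hz.2, max_eq_right hz.1]
  have hν : ∀ A, MeasurableSet A → μ.withDensity (fun z => ENNReal.ofReal (H z)) A =
      ENNReal.ofReal (∫ z in A, g z ∂μ) := by
    intro A hA
    rw [withDensity_apply _ hA, ← ofReal_integral_eq_lintegral_ofReal]
    · exact congrArg _ (integral_congr_ae (ae_restrict_of_ae hHg))
    · exact ((L1.integrable_coeFn g).congr hHg.symm).integrableOn
    · exact ae_of_all _ fun z => (hH0 z).1
  refine ⟨H, hHm, hH0, ⟨hΘ, Measure.ext fun A hA => ?_⟩, fun A hA hAn => ?_⟩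
  · rw [Measure.map_apply hΘ hA, hν A hA, hν _ (hΘ hA)]
    congr 1
    -- The averages of `A` and of `Θ⁻¹ A` differ by a telescoping sum divided by their length.
    have hd : ∀ N, a N (Θ ⁻¹' A) = a N A +
        ((N : ℝ) + 1)⁻¹ * (μ.real (Θ^[N + 1] ⁻¹' A) - μ.real A) := by
      intro N
      rw [ha]
      simp only
      rw [← mul_add]
      congr 1
      have h1 : ∀ n, μ.real (Θ^[n] ⁻¹' (Θ ⁻¹' A)) = μ.real (Θ^[n + 1] ⁻¹' A) := fun n => by
        rw [← preimage_comp, ← Function.iterate_succ']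
      simp only [h1]
      rw [Finset.sum_range_succ (fun n => μ.real (Θ^[n + 1] ⁻¹' A)),
        Finset.sum_range_succ' (fun n => μ.real (Θ^[n] ⁻¹' A))]
      simp
    have h0 : Tendsto (fun N : ℕ => ((N : ℝ) + 1)⁻¹ * (μ.real (Θ^[N + 1] ⁻¹' A) - μ.real A))
        atTop (𝓝 0) := by
      refine squeeze_zero_norm (a := fun N : ℕ => 1 / ((N : ℝ) + 1)) (fun N => ?_)
        tendsto_one_div_add_atTop_nhds_zero_nat
      rw [norm_mul, one_div, Real.norm_of_nonneg (by positivity : (0 : ℝ) ≤ ((N : ℝ) + 1)⁻¹)]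
      refine mul_le_of_le_one_right (by positivity) (abs_le.2 ⟨?_, ?_⟩) <;>
      linarith [measureReal_le_one (μ := μ) (s := A), measureReal_nonneg (μ := μ) (s := A),
        measureReal_le_one (μ := μ) (s := Θ^[N + 1] ⁻¹' A),
        measureReal_nonneg (μ := μ) (s := Θ^[N + 1] ⁻¹' A)]
    have h2 := (hlimA A hA).add (h0.comp hk.tendsto_atTop)
    rw [add_zero] at h2
    exact tendsto_nhds_unique (hlimA _ (hΘ hA)) (h2.congr fun j => (hd (k j)).symm)
  · rw [hν A hA, tendsto_nhds_unique (hlimA A hA)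
      (tendsto_const_nhds.congr (f₁ := fun _ => μ.real A) fun j => ?_)]
    · simp [measureReal_def]
    · rw [ha]
      simp only [measureReal_def, hAn]
      simp only [Finset.sum_const, Finset.card_range, nsmul_eq_mul, Nat.cast_add, Nat.cast_one]
      field_simp

/-- The support `S` of the density of an invariant measure `ν` is forward invariant, and almost
every orbit enters it if `ν` and `μ` agree on invariant sets: the set `D` of the points whose orbit
avoids `S` is invariant, whence `μ(D) = ν(D) = 0`. -/
theorem ae_monotone_and_tendsto_indicator_support {μ : Measure Z} {Θ : Z → Z}
    (hΘ : Measure.QuasiMeasurePreserving Θ μ μ) {H : Z → ℝ} (hHm : Measurable H)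
    (hH0 : ∀ z, 0 ≤ H z)
    (hinv : MeasurePreserving Θ (μ.withDensity fun z => ENNReal.ofReal (H z))
      (μ.withDensity fun z => ENNReal.ofReal (H z)))
    (hagree : ∀ A, MeasurableSet A → (∀ n, μ (Θ^[n] ⁻¹' A) = μ A) →
      μ.withDensity (fun z => ENNReal.ofReal (H z)) A = μ A) :
    ∀ᵐ z ∂μ, Monotone (fun n : ℕ => (Function.support H).indicator (fun _ => (1 : ℝ)) (Θ^[n] z)) ∧
      Tendsto (fun n : ℕ => (Function.support H).indicator (fun _ => (1 : ℝ)) (Θ^[n] z)) atTop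
        (𝓝 1) := by
  set ν := μ.withDensity fun z => ENNReal.ofReal (H z) with hν
  set S := Function.support H
  have hS : MeasurableSet S := measurableSet_support hHm
  have hfm : Measurable fun z => ENNReal.ofReal (H z) := ENNReal.measurable_ofReal.comp hHm
  have hsupp : {z | ENNReal.ofReal (H z) ≠ 0} = S := by
    ext z
    simp only [mem_ofPred_eq, ne_eq, ENNReal.ofReal_eq_zero, not_le, S, Function.mem_support]
    exact (hH0 z).lt_iff_ne'
  have hνnull : ∀ A, ν A = 0 ↔ μ (S ∩ A) = 0 := fun A => by
    rw [hν, withDensity_apply_eq_zero hfm, hsupp]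
  have hstep : ∀ᵐ z ∂μ, z ∈ S → Θ z ∈ S := by
    have h1 : ν (Θ ⁻¹' Sᶜ) = 0 := by
      rw [hinv.measure_preimage hS.compl.nullMeasurableSet, hνnull, inter_compl_self, measure_empty]
    rw [hνnull] at h1
    rw [ae_iff]
    refine measure_mono_null (fun z hz => ?_) h1
    simpa using hz
  have hsteps : ∀ᵐ z ∂μ, ∀ n, Θ^[n] z ∈ S → Θ^[n + 1] z ∈ S := by
    rw [ae_all_iff]
    intro n
    filter_upwards [(hΘ.iterate n).ae hstep] with z hz
    rwa [Function.iterate_succ_apply']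
  have hmono : ∀ᵐ z ∂μ, ∀ n k, n ≤ k → Θ^[n] z ∈ S → Θ^[k] z ∈ S := by
    filter_upwards [hsteps] with z hz n k hnk hn
    induction k, hnk using Nat.le_induction with
    | base => exact hn
    | succ k _ ih => exact hz k ih
  set D := ⋂ n, Θ^[n] ⁻¹' Sᶜ with hD
  have hDm : MeasurableSet D := MeasurableSet.iInter fun n => (hΘ.measurable.iterate n) hS.compl
  have hμD : μ D = 0 := by
    rw [← hagree D hDm fun n => measure_congr ?_, hνnull]
    · rw [hD]
      convert measure_empty (μ := μ)
      refine eq_empty_of_forall_notMem fun z hz => ?_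
      exact mem_iInter.1 hz.2 0 hz.1
    · filter_upwards [hmono] with z hz
      refine propext ⟨fun h => mem_iInter.2 fun k hk => ?_, fun h => mem_iInter.2 fun k => ?_⟩
      · refine mem_iInter.1 h k ?_
        rw [← Function.iterate_add_apply]
        exact hz k (k + n) (by omega) hk
      · rw [mem_preimage, ← Function.iterate_add_apply]
        exact mem_iInter.1 h (k + n)
  have hhit : ∀ᵐ z ∂μ, z ∉ D := measure_eq_zero_iff_ae_notMem.1 hμD
  filter_upwards [hmono, hhit] with z hz hzD
  have hm : Monotone fun n : ℕ => S.indicator (fun _ => (1 : ℝ)) (Θ^[n] z) := by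
    intro n k hnk
    by_cases hn : Θ^[n] z ∈ S
    · simp [hn, hz n k hnk hn]
    · simp only [hn, not_false_eq_true, indicator_of_notMem]
      exact indicator_nonneg (fun _ _ => zero_le_one) _
  refine ⟨hm, ?_⟩
  obtain ⟨n, hn⟩ : ∃ n, Θ^[n] z ∈ S := by
    by_contra! h
    exact hzD (mem_iInter.2 h)
  refine tendsto_const_nhds.congr' ?_
  filter_upwards [eventually_ge_atTop n] with k hk
  simp [hz n k hk hn]

end Invariant

/-! ### The skew product and its fibres -/

section Fibers

variable {Ω X : Type*}

/-- The skew product `(ω, x) ↦ (σ ω, T_ω x)`. -/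
def skewProduct (σ : Ω → Ω) (T : Ω → X → X) (z : Ω × X) : Ω × X := (σ z.1, T z.1 z.2)

theorem skewProduct_iterate (σ : Ω → Ω) (T : Ω → X → X) (n : ℕ) (z : Ω × X) :
    (skewProduct σ T)^[n] z = (σ^[n] z.1, cocycle σ T n z.1 z.2) := by
  induction n with
  | zero => rfl
  | succ n ih => rw [Function.iterate_succ_apply', ih, Function.iterate_succ_apply']; rfl

variable [MeasurableSpace Ω]

theorem liftAdjoint_iterate (σ : Ω ≃ᵐ Ω) (T : Ω → X → X) (n : ℕ) (g : Ω × X → ℝ) (z : Ω × X) :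
    (liftAdjoint σ T)^[n] g z = g ((skewProduct σ T)^[n] z) := by
  induction n generalizing g with
  | zero => rfl
  | succ n ih => rw [Function.iterate_succ_apply, ih, Function.iterate_succ_apply']; rfl

variable [MeasurableSpace X]

theorem measurable_skewProduct {σ : Ω → Ω} (hσ : Measurable σ) {T : Ω → X → X}
    (hT : Measurable (Function.uncurry T)) : Measurable (skewProduct σ T) :=
  (hσ.comp measurable_fst).prodMk hT

/-- A map into a separable metric space is strongly measurable as soon as its distances to all
points are measurable functions. -/
theorem stronglyMeasurable_of_measurable_dist {E : Type*} [PseudoMetricSpace E]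
    [SecondCountableTopology E] {h : Ω → E} (hd : ∀ e, Measurable fun ω => dist (h ω) e) :
    StronglyMeasurable h := by
  borelize E
  refine Measurable.stronglyMeasurable (measurable_of_isOpen fun U hU => ?_)
  have : ∀ x : U, ∃ r > 0, Metric.ball (x : E) r ⊆ U := fun x => Metric.isOpen_iff.1 hU x x.2
  choose r hr hrU using this
  obtain ⟨s, hs, hsU⟩ := TopologicalSpace.isOpen_iUnion_countable
    (fun x : U => Metric.ball (x : E) (r x)) fun _ => Metric.isOpen_ball
  have hUeq : U = ⋃ x ∈ s, Metric.ball (x : E) (r x) := by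
    rw [hsU]
    exact Subset.antisymm (fun x hx => mem_iUnion.2 ⟨⟨x, hx⟩, Metric.mem_ball_self (hr _)⟩)
      (iUnion_subset hrU)
  rw [hUeq, preimage_iUnion₂]
  exact MeasurableSet.biUnion hs fun x _ => measurableSet_lt (hd x) measurable_const

/-- The fibres `x ↦ H (ω, x)` of a jointly measurable function depend strongly measurably on `ω`,
as elements of `L¹`. -/
theorem stronglyMeasurable_toL1_prodMk [MeasurableSpace.CountablyGenerated X] {m : Measure X}
    [IsFiniteMeasure m] {H : Ω × X → ℝ} (hH : Measurable H)
    (hi : ∀ ω, Integrable (fun x => H (ω, x)) m) :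
    StronglyMeasurable fun ω => (hi ω).toL1 fun x => H (ω, x) := by
  have : Fact ((1 : ENNReal) ≠ ⊤) := ⟨by norm_num⟩
  refine stronglyMeasurable_of_measurable_dist fun f => ?_
  have h : ∀ ω, dist ((hi ω).toL1 fun x => H (ω, x)) f = ∫ x, ‖H (ω, x) - f x‖ ∂m := by
    intro ω
    rw [L1.dist_eq_integral_dist]
    refine integral_congr_ae ?_
    filter_upwards [(hi ω).coeFn_toL1] with x hx
    rw [hx, Real.dist_eq, Real.norm_eq_abs]
  simp_rw [h]
  refine (StronglyMeasurable.integral_prod_right' (ν := m)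
    (f := fun z : Ω × X => ‖H z - f z.2‖) ?_).measurable
  exact (hH.sub ((Lp.stronglyMeasurable f).measurable.comp measurable_snd)).norm.stronglyMeasurable

/-- A bound on the iterates from the past, uniform over a.e. fibre, gives the same bound for the
iterates of the skew product: start the fibres at time `-n`, which does not change `ℙ`. -/
theorem measure_skewProduct_iterate_preimage_le {ℙ : Measure Ω} [IsProbabilityMeasure ℙ]
    {m : Measure X} [IsProbabilityMeasure m] {σ : Ω ≃ᵐ Ω} (hσ : MeasurePreserving σ ℙ ℙ)
    {T : Ω → X → X} (hT : Measurable (Function.uncurry T)) {K : ℝ≥0∞}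
    (hK : ∀ᵐ ω ∂ℙ, ∀ n : ℕ, ∀ A, MeasurableSet A → m (pastMap σ T ω n ⁻¹' A) ≤ K * m A)
    (n : ℕ) (A : Set (Ω × X)) (hA : MeasurableSet A) :
    ℙ.prod m ((skewProduct σ T)^[n] ⁻¹' A) ≤ K * ℙ.prod m A := by
  have hΘ := (measurable_skewProduct σ.measurable hT).iterate n
  have hsymm : ∀ ω, σ^[n] (σ.symm^[n] ω) = ω :=
    (Function.LeftInverse.iterate σ.apply_symm_apply n)
  have hmp : MeasurePreserving (σ.symm^[n]) ℙ ℙ := (hσ.symm σ).iterate n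
  have hm : Measurable fun ω => m (Prod.mk ω ⁻¹' ((skewProduct σ T)^[n] ⁻¹' A)) :=
    measurable_measure_prodMk_left (hΘ hA)
  rw [Measure.prod_apply (hΘ hA), Measure.prod_apply hA, ← hmp.lintegral_comp hm,
    ← lintegral_const_mul _ (measurable_measure_prodMk_left hA)]
  refine lintegral_mono_ae ?_
  filter_upwards [hK] with ω hω
  refine le_trans (le_of_eq ?_) (hω n _ (measurable_prodMk_left hA))
  congr 1
  ext x
  simp only [mem_preimage, skewProduct_iterate, hsymm]
  rfl

section Kernel

open ProbabilityTheory

/-- If `F` is the density with respect to `P × m` of a measure invariant under the skew product,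
then `T_ω` carries the fibre measure `F (ω, ·) m` to `F (σ ω, ·) m`: the two kernels have the same
composition product with `P`. -/
theorem ae_map_withDensity_eq [MeasurableSpace.CountablyGenerated X] {P : Measure Ω}
    [IsProbabilityMeasure P] {m : Measure X} [IsProbabilityMeasure m] {σ : Ω ≃ᵐ Ω}
    (hσ : MeasurePreserving σ P P) {T : Ω → X → X} (hT : Measurable (Function.uncurry T))
    {F : Ω × X → ℝ≥0∞} (hF : Measurable F) {K : ℝ≥0∞} (hK : K ≠ ∞) (hFK : ∀ z, F z ≤ K)
    (hinv : MeasurePreserving (skewProduct σ T) ((P.prod m).withDensity F)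
      ((P.prod m).withDensity F)) :
    ∀ᵐ ω ∂P, m.withDensity (fun x => F (σ ω, x)) =
      (m.withDensity fun x => F (ω, x)).map (T ω) := by
  have hFu : Measurable (Function.uncurry fun ω x => F (ω, x)) := hF
  set κ : Kernel Ω X := (Kernel.const Ω m).withDensity fun ω x => F (ω, x) with hκ
  have : IsFiniteKernel κ :=
    Kernel.isFiniteKernel_withDensity_of_bounded _ hK fun ω x => hFK (ω, x)
  have hκa : ∀ ω, κ ω = m.withDensity fun x => F (ω, x) := fun ω => by
    rw [hκ, Kernel.withDensity_apply _ hFu, Kernel.const_apply]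
  set κ₁ : Kernel Ω X := κ.comap σ σ.measurable with hκ₁
  set κ₂ : Kernel Ω X := (Kernel.id ×ₖ κ).map (Function.uncurry T) with hκ₂
  have : IsFiniteKernel κ₂ := by rw [hκ₂]; infer_instance
  have hκ₂a : ∀ ω, κ₂ ω = (κ ω).map (T ω) := fun ω => by
    rw [hκ₂, Kernel.map_apply _ hT, Kernel.prod_apply, Kernel.id_apply, Measure.dirac_prod,
      Measure.map_map hT measurable_prodMk_left]
    rfl
  have hν : ∀ s, MeasurableSet s →
      (P.prod m).withDensity F s = ∫⁻ ω, κ ω (Prod.mk ω ⁻¹' s) ∂P := by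
    intro s hs
    rw [← Measure.compProd_apply hs, hκ, Measure.compProd_withDensity hFu, Measure.compProd_const]
  suffices h : P ⊗ₘ κ₁ = P ⊗ₘ κ₂ by
    filter_upwards [Kernel.ae_eq_of_compProd_eq h] with ω hω
    rw [← hκa, ← hκa, ← hκ₂a, ← hω]
    rfl
  ext s hs
  have hE : MeasurableSet ((fun z : Ω × X => (σ.symm z.1, z.2)) ⁻¹' s) :=
    ((σ.symm.measurable.comp measurable_fst).prodMk measurable_snd) hs
  have h1 : (P ⊗ₘ κ₁) s =
      (P.prod m).withDensity F ((fun z : Ω × X => (σ.symm z.1, z.2)) ⁻¹' s) := by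
    rw [hν _ hE, Measure.compProd_apply hs, ← hσ.lintegral_comp
      (Kernel.measurable_kernel_prodMk_left hE)]
    refine lintegral_congr fun ω => ?_
    rw [hκ₁, Kernel.comap_apply]
    congr 1
    ext x
    simp
  have h2 : (P ⊗ₘ κ₂) s = (P.prod m).withDensity F
      (skewProduct σ T ⁻¹' ((fun z : Ω × X => (σ.symm z.1, z.2)) ⁻¹' s)) := by
    rw [hν _ (hinv.measurable hE), Measure.compProd_apply hs]
    refine lintegral_congr fun ω => ?_
    rw [hκ₂a, Measure.map_apply (show Measurable (T ω) from hT.comp measurable_prodMk_left)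
      (measurable_prodMk_left hs)]
    congr 1
    ext x
    simp [skewProduct]
  rw [h1, h2, hinv.measure_preimage hE.nullMeasurableSet]

end Kernel

end Fibers

/-! ### The random invariant density -/

/-- If the iterates from the past distort `m` by at most a constant factor, uniformly over a.e.
fibre, there is a random invariant density whose support sweeps out the whole space. -/
theorem exists_randomInvariantDensity_of_bounded {Ω X : Type*} [MeasurableSpace Ω]
    [MeasurableSpace.CountablyGenerated Ω] [MeasurableSpace X]
    [MeasurableSpace.CountablyGenerated X] {ℙ : Measure Ω} [IsProbabilityMeasure ℙ]
    {m : Measure X} [IsProbabilityMeasure m] {σ : Ω ≃ᵐ Ω} (hσ : MeasurePreserving σ ℙ ℙ)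
    {T : Ω → X → X} (hTmeas : Measurable (Function.uncurry T))
    (hT : ∀ ω, Measure.QuasiMeasurePreserving (T ω) m m) {K : ℝ} (hK : 0 ≤ K)
    (hb : ∀ᵐ ω ∂ℙ, ∀ n : ℕ, ∀ A, MeasurableSet A →
      m (pastMap σ T ω n ⁻¹' A) ≤ ENNReal.ofReal K * m A) :
    ∃ h : Ω → Lp ℝ 1 m, IsRandomInvariantDensity ℙ m σ (fun ω => transferOp m (T ω)) h ∧
      SupportSweepsOut ℙ m σ T h := by
  have hΘ := measurable_skewProduct σ.measurable hTmeas
  have hbΘ := measure_skewProduct_iterate_preimage_le hσ hTmeas hb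
  have hqΘ : Measure.QuasiMeasurePreserving (skewProduct σ T) (ℙ.prod m) (ℙ.prod m) :=
    ⟨hΘ, Measure.AbsolutelyContinuous.mk fun A hA h0 => by
      rw [Measure.map_apply hΘ hA, ← nonpos_iff_eq_zero]
      exact (hbΘ 1 A hA).trans_eq (by rw [h0, mul_zero])⟩
  obtain ⟨H, hHm, hHK, hinv, hagree⟩ := exists_bounded_invariant_density (ℙ.prod m) hΘ hK hbΘ
  have hHω : ∀ ω, Measurable fun x => H (ω, x) := fun ω => hHm.comp measurable_prodMk_left
  have hi : ∀ ω, Integrable (fun x => H (ω, x)) m := fun ω =>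
    Integrable.of_bound (hHω ω).aestronglyMeasurable K (ae_of_all _ fun x => by
      rw [Real.norm_of_nonneg (hHK _).1]; exact (hHK _).2)
  set F : Ω × X → ℝ≥0∞ := fun z => ENNReal.ofReal (H z) with hF
  have hFm : Measurable F := ENNReal.measurable_ofReal.comp hHm
  have hset : ∀ ω A, MeasurableSet A → ENNReal.ofReal (∫ x in A, H (ω, x) ∂m) =
      m.withDensity (fun x => F (ω, x)) A := fun ω A hA => by
    rw [withDensity_apply _ hA, ofReal_integral_eq_lintegral_ofReal (hi ω).integrableOn
      (ae_of_all _ fun x => (hHK _).1)]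
  have hset0 : ∀ ω A, 0 ≤ ∫ x in A, H (ω, x) ∂m := fun ω A =>
    setIntegral_nonneg_of_ae (ae_of_all _ fun x => (hHK _).1)
  -- Sets `B × X` keep their measure under the iterates, so the invariant measure projects to `ℙ`.
  have hone : ∀ᵐ ω ∂ℙ, ∫⁻ x, F (ω, x) ∂m = 1 := by
    refine ae_eq_of_forall_setLIntegral_eq_of_sigmaFinite hFm.lintegral_prod_right'
      measurable_const fun B hB _ => ?_
    have h := hagree (B ×ˢ univ) (hB.prod MeasurableSet.univ) fun n => by
      have : (skewProduct σ T)^[n] ⁻¹' (B ×ˢ univ) = (σ^[n] ⁻¹' B) ×ˢ univ := by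
        ext z; simp [skewProduct_iterate]
      rw [this, Measure.prod_prod, Measure.prod_prod,
        (hσ.iterate n).measure_preimage hB.nullMeasurableSet]
    rw [withDensity_apply _ (hB.prod MeasurableSet.univ), ← Measure.prod_restrict,
      Measure.restrict_univ, lintegral_prod _ hFm.aemeasurable, Measure.prod_prod] at h
    simpa using h
  refine ⟨fun ω => (hi ω).toL1 _, ⟨stronglyMeasurable_toL1_prodMk hHm hi, ?_⟩, H, hHm,
    ae_of_all _ fun ω => (hi ω).coeFn_toL1.symm, ?_⟩
  · filter_upwards [hone, ae_map_withDensity_eq hσ hTmeas hFm ENNReal.ofReal_ne_top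
      (fun z => ENNReal.ofReal_le_ofReal (hHK z).2) hinv] with ω h1 hmap
    refine ⟨⟨?_, ?_⟩, ?_⟩
    · rw [← Lp.coeFn_nonneg]
      filter_upwards [(hi ω).coeFn_toL1] with x hx
      rw [hx]
      exact (hHK _).1
    · rw [L1.norm_eq_integral_norm, integral_congr_ae (g := fun x => H (ω, x))]
      · have h := hset ω univ MeasurableSet.univ
        rw [withDensity_apply _ MeasurableSet.univ, Measure.restrict_univ, h1,
          ENNReal.ofReal_eq_one] at h
        exact h
      · filter_upwards [(hi ω).coeFn_toL1] with x hx
        rw [hx, Real.norm_of_nonneg (hHK _).1]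
    · refine Lp.ext (Integrable.ae_eq_of_forall_setIntegral_eq _ _ (L1.integrable_coeFn _)
        (L1.integrable_coeFn _) fun A hA _ => ?_)
      rw [setIntegral_transferOp m (hT ω) _ hA,
        integral_congr_ae (ae_restrict_of_ae (hi ω).coeFn_toL1),
        integral_congr_ae (ae_restrict_of_ae (hi (σ ω)).coeFn_toL1),
        ← ENNReal.ofReal_eq_ofReal_iff (hset0 _ _) (hset0 _ _), hset _ _ hA,
        hset _ _ ((hT ω).measurable hA), hmap, Measure.map_apply (hT ω).measurable hA]
  · simp only [liftAdjoint_iterate]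
    exact ae_monotone_and_tendsto_indicator_support hqΘ hHm (fun z => (hHK z).1) hinv hagree

end RandomFibered

theorem mainTheorem3 {Ω X I : Type*}
    [MeasurableSpace Ω] [StandardBorelSpace Ω] [MeasurableSpace X] [StandardBorelSpace X]
    [Nonempty I] [Countable I]
    (ℙ : Measure Ω) [IsProbabilityMeasure ℙ] (m : Measure X) [IsProbabilityMeasure m]
    (σ : Ω ≃ᵐ Ω) (hσ : Ergodic σ ℙ)
    (T : Ω → X → X) (hTmeas : Measurable (Function.uncurry T))
    (hTns : ∀ ω, Measure.QuasiMeasurePreserving (T ω) m m)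
    (Y : I → Set X) (hY : IsPartitionModNull m Y)
    (hinj : ∀ᵐ ω ∂ℙ, ∀ i, InjOn (T ω) (Y i))
    (hgen : GeneratorCondition ℙ m σ T Y)
    (hdist : BoundedDistortion ℙ m σ T Y)
    (himg : LargeImages ℙ m σ T Y) :
    (∀ᵐ ω ∂ℙ, UniformlyIntegrableSeq m (pushedOne m σ T ω)) ∧
    (∀ᵐ ω ∂ℙ, WeaklyPrecompact (Set.range (pushedOne m σ T ω))) ∧
    ∃ h : Ω → Lp ℝ 1 m,
      IsRandomInvariantDensity ℙ m σ (fun ω => transferOp m (T ω)) h ∧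
      SupportSweepsOut ℙ m σ T h := by
  obtain ⟨K, hK, hb⟩ := exists_measure_pastMap_preimage_le hTns hY hdist himg
  have hbd : ∀ᵐ ω ∂ℙ, ∀ n, ∀ᵐ x ∂m, |pushedOne m σ T ω n x| ≤ K :=
    hb.mono fun ω hω n => ae_abs_pushedOne_le hTns hK (hω n)
  refine ⟨hbd.mono fun ω hω => uniformlyIntegrableSeq_of_ae_abs_le hK hω,
    hbd.mono fun ω hω u hu => ?_,
    exists_randomInvariantDensity_of_bounded hσ.toMeasurePreserving hTmeas hTns hK hb⟩
  refine weaklyPrecompact_setOf_ae_abs_le m K u fun n => ?_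
  obtain ⟨k, hk⟩ := hu n
  rw [← hk]
  exact hω k
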